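/- Let $L^2(0,1)$ and $\ell^2$ be the usual real Hilbert spaces. For $k\in\{0,1,2,\dots\}$ let $H^k(0,1)$ be the Sobolev space of all $x\in L^2(0,1)$ whose weak derivatives $x^{(j)}$, $0\le j\le k$, belong to $L^2(0,1)$, with norm $\|x\|_{H^k(0,1)}=\bigl(\sum_{j=0}^k\|x^{(j)}\|_{L^2(0,1)}^2\bigr)^{1/2}$ (so $H^0(0,1)=L^2(0,1)$), and let $\mathcal E^{(k)}\colon H^k(0,1)\hookrightarrow L^2(0,1)$ be the natural embedding. Let $J\colon L^2(0,1)\to L^2(0,1)$, $[Jx](s)=\int_0^s x(t)\,dt$ for $0\le s\le 1$, be the integration operator, and let $B^{(H)}\colon L^2(0,1)\to\ell^2$, $[B^{(H)}z]_j=\int_0^1 t^{j-1}z(t)\,dt$ for $j=1,2,\dots$, be the Hausdorff moment operator. There are constants $C_k>0$, depending only on $k=0,1,2,\dots$, such that the following hold. (a) For every $k=0,1,2,\dots$, for all sufficiently small $\delta>0$ (where the smallness may depend on $k$), $$\sup\{\|x\|_{L^2(0,1)} : x\in H^k(0,1),\ \|B^{(H)}(\mathcal E^{(k)}x)\|_{\ell^2}\le\delta,\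 \|x\|_{H^k(0,1)}\le 1\}\le\frac{C_k}{(\ln(1/\delta))^k}.$$ (b) For all sufficiently small $\delta>0$, $$\sup\{\|Jx\|_{L^2(0,1)} : x\in L^2(0,1),\ \|B^{(H)}(Jx)\|_{\ell^2}\le\delta,\ \|x\|_{L^2(0,1)}\le 1\}\le\frac{C_0}{\ln(1/\delta)}.$$ -/

import Mathlib

open MeasureTheory Filter Topology
open scoped ContDiff

noncomputable section

namespace HausdorffMoment

/-- Lebesgue measure on the open unit interval `(0,1)`. -/
abbrev unitMeasure : Measure ℝ := volume.restrict (Set.Ioo (0 : ℝ) 1)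

/-- The real Hilbert space `L²(0,1)`. -/
abbrev L2 : Type := Lp ℝ 2 unitMeasure

/-- The real sequence space `ℓ²`, with indices starting at `0`. -/
abbrev SeqL2 : Type := lp (fun _ : ℕ => ℝ) 2

/-! ### The Hausdorff moment operator -/

/-- The moment `∫₀¹ t ^ j z(t) dt` for `j = 0, 1, 2, …`. -/
def moment (z : L2) (j : ℕ) : ℝ := ∫ t in Set.Ioo (0 : ℝ) 1, t ^ j * z t

theorem memLp_monomial (j : ℕ) : MemLp (fun t : ℝ => t ^ j) 2 unitMeasure := by
  refine MemLp.of_bound (by fun_prop) 1 ?_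
  filter_upwards [ae_restrict_mem measurableSet_Ioo] with t ht
  rw [Real.norm_eq_abs, abs_of_nonneg (pow_nonneg ht.1.le _)]
  exact pow_le_one₀ ht.1.le ht.2.le

/-- The monomial `t ↦ t ^ j` as an element of `L²(0,1)`. -/
def monomialL2 (j : ℕ) : L2 := (memLp_monomial j).toLp _

theorem moment_eq_inner (z : L2) (j : ℕ) : moment z j = inner ℝ (monomialL2 j) z := by
  rw [L2.inner_def, moment]
  refine integral_congr_ae ?_
  filter_upwards [(memLp_monomial j).coeFn_toLp] with t ht
  rw [monomialL2, ht]
  simp [mul_comm]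

theorem inner_monomialL2 (i j : ℕ) :
    inner ℝ (monomialL2 i) (monomialL2 j) = 1 / ((i : ℝ) + j + 1) := by
  rw [← moment_eq_inner, moment]
  have h : ∫ t in Set.Ioo (0 : ℝ) 1, t ^ i * monomialL2 j t
      = ∫ t in Set.Ioo (0 : ℝ) 1, t ^ (i + j) := by
    refine integral_congr_ae ?_
    filter_upwards [(memLp_monomial j).coeFn_toLp] with t ht
    rw [monomialL2, ht, pow_add]
  rw [h, ← integral_Ioc_eq_integral_Ioo, ← intervalIntegral.integral_of_le zero_le_one,
    integral_pow]
  simp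

theorem schur_sum (i n : ℕ) :
    ∑ j ∈ Finset.range n, 1 / ((i : ℝ) + j + 1) * (1 / √((j : ℝ) + 1))
      ≤ 4 * (1 / √((i : ℝ) + 1)) := by
  have hi : (0 : ℝ) < i + 1 := by positivity
  have hsi : 0 < √((i : ℝ) + 1) := Real.sqrt_pos.2 hi
  have h1 : ∀ m : ℕ, ∑ j ∈ Finset.range m, 1 / √((j : ℝ) + 1) ≤ 2 * √(m : ℝ) := by
    intro m
    induction m with
    | zero => simp
    | succ m ih =>
      rw [Finset.sum_range_succ]
      push_cast
      have hm : (0 : ℝ) ≤ m := by positivity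
      have ha := Real.sq_sqrt hm
      have hb := Real.sq_sqrt (show (0 : ℝ) ≤ m + 1 by positivity)
      have hbp : 0 < √((m : ℝ) + 1) := Real.sqrt_pos.2 (by positivity)
      have : 1 / √((m : ℝ) + 1) ≤ 2 * √((m : ℝ) + 1) - 2 * √(m : ℝ) := by
        rw [div_le_iff₀ hbp]
        nlinarith [sq_nonneg (√((m : ℝ) + 1) - √(m : ℝ))]
      linarith
  have h2 : ∀ m : ℕ, ∑ j ∈ Finset.range m,
      1 / ((i : ℝ) + 1 + j + 1) * (1 / √((i : ℝ) + 1 + j + 1))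
        ≤ 2 / √((i : ℝ) + 1) - 2 / √((i : ℝ) + 1 + m) := by
    intro m
    induction m with
    | zero => simp
    | succ m ih =>
      rw [Finset.sum_range_succ]
      push_cast
      have hap : 0 < √((i : ℝ) + 1 + m) := Real.sqrt_pos.2 (by positivity)
      have hbp : 0 < √((i : ℝ) + 1 + m + 1) := Real.sqrt_pos.2 (by positivity)
      have ha := Real.sq_sqrt (show (0 : ℝ) ≤ i + 1 + m by positivity)
      have hb := Real.sq_sqrt (show (0 : ℝ) ≤ i + 1 + m + 1 by positivity)
      have : 1 / ((i : ℝ) + 1 + m + 1) * (1 / √((i : ℝ) + 1 + m + 1))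
          ≤ 2 / √((i : ℝ) + 1 + m) - 2 / √((i : ℝ) + 1 + m + 1) := by
        rw [div_sub_div _ _ hap.ne' hbp.ne', div_mul_div_comm, one_mul,
          div_le_div_iff₀ (by positivity) (by positivity)]
        set a := √((i : ℝ) + 1 + m)
        set b := √((i : ℝ) + 1 + m + 1)
        rw [← hb]
        have hd : (b - a) * (b + a) = 1 := by nlinarith
        have hab : a ≤ b := Real.sqrt_le_sqrt (by linarith)
        have hge : 1 ≤ (b - a) * (2 * b) := by nlinarith
        have hle : a * b ≤ b ^ 2 := by nlinarith
        calc 1 * (a * b) ≤ b ^ 2 * 1 := by linarith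
          _ ≤ b ^ 2 * ((b - a) * (2 * b)) := by gcongr
          _ = (2 * b - a * 2) * (b ^ 2 * b) := by ring
      have e : (i : ℝ) + 1 + (m + 1) = i + 1 + m + 1 := by ring
      rw [e]
      linarith
  calc ∑ j ∈ Finset.range n, 1 / ((i : ℝ) + j + 1) * (1 / √((j : ℝ) + 1))
      ≤ ∑ j ∈ Finset.range (i + 1 + n), 1 / ((i : ℝ) + j + 1) * (1 / √((j : ℝ) + 1)) :=
        Finset.sum_le_sum_of_subset_of_nonneg
          (Finset.range_mono (by omega)) (fun _ _ _ => by positivity)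
    _ = ∑ j ∈ Finset.range (i + 1), 1 / ((i : ℝ) + j + 1) * (1 / √((j : ℝ) + 1))
        + ∑ j ∈ Finset.range n, 1 / ((i : ℝ) + ((i + 1 + j : ℕ) : ℝ) + 1)
            * (1 / √(((i + 1 + j : ℕ) : ℝ) + 1)) := Finset.sum_range_add _ _ _
    _ ≤ ∑ j ∈ Finset.range (i + 1), 1 / ((i : ℝ) + 1) * (1 / √((j : ℝ) + 1))
        + ∑ j ∈ Finset.range n, 1 / ((i : ℝ) + 1 + j + 1)
            * (1 / √((i : ℝ) + 1 + j + 1)) := by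
        refine add_le_add (Finset.sum_le_sum fun j _ => ?_) (Finset.sum_le_sum fun j _ => ?_)
        · have : (0 : ℝ) ≤ j := by positivity
          gcongr
          linarith
        · have e : ((i + 1 + j : ℕ) : ℝ) = (i : ℝ) + 1 + j := by push_cast; ring
          rw [e]
          have : (0 : ℝ) ≤ i := by positivity
          exact mul_le_mul_of_nonneg_right
            (one_div_le_one_div_of_le (by positivity) (by linarith)) (by positivity)
    _ ≤ 1 / ((i : ℝ) + 1) * (2 * √((i : ℝ) + 1)) + 2 / √((i : ℝ) + 1) := by
        rw [← Finset.mul_sum]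
        have k1 := h1 (i + 1)
        have k2 := h2 n
        push_cast at k1
        have k3 : 0 ≤ 2 / √((i : ℝ) + 1 + n) := by positivity
        gcongr
        linarith
    _ = 4 * (1 / √((i : ℝ) + 1)) := by
        have hb := Real.sq_sqrt hi.le
        rw [← hb, Real.sqrt_sq hsi.le]
        field_simp
        norm_num

theorem hilbert_form_le (a : ℕ → ℝ) (n : ℕ) :
    ∑ i ∈ Finset.range n, ∑ j ∈ Finset.range n, a i * a j * (1 / ((i : ℝ) + j + 1))
      ≤ 4 * ∑ i ∈ Finset.range n, a i ^ 2 := by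
  set w : ℕ → ℝ := fun i => √((i : ℝ) + 1) with hw
  have hwp : ∀ i, 0 < w i := fun i => Real.sqrt_pos.2 (by positivity)
  have key : ∀ i j : ℕ, a i * a j * (1 / ((i : ℝ) + j + 1))
      ≤ (a i ^ 2 * w i * (1 / ((i : ℝ) + j + 1) * (1 / w j))
        + a j ^ 2 * w j * (1 / ((j : ℝ) + i + 1) * (1 / w i))) / 2 := by
    intro i j
    have hc : (0 : ℝ) < 1 / ((i : ℝ) + j + 1) := by positivity
    have e : (j : ℝ) + i + 1 = i + j + 1 := by ring
    rw [e]
    have h : a i * a j ≤ (a i ^ 2 * w i * (1 / w j) + a j ^ 2 * w j * (1 / w i)) / 2 := by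
      have hi := hwp i
      have hj := hwp j
      have e2 : (a i ^ 2 * w i * (1 / w j) + a j ^ 2 * w j * (1 / w i)) / 2 - a i * a j
          = (a i * w i - a j * w j) ^ 2 / (2 * w i * w j) := by
        field_simp
        ring
      have : 0 ≤ (a i * w i - a j * w j) ^ 2 / (2 * w i * w j) := by positivity
      linarith
    calc _ ≤ (a i ^ 2 * w i * (1 / w j) + a j ^ 2 * w j * (1 / w i)) / 2
          * (1 / ((i : ℝ) + j + 1)) := by gcongr
      _ = _ := by ring
  have row : ∀ i : ℕ, ∑ j ∈ Finset.range n, a i ^ 2 * w i * (1 / ((i : ℝ) + j + 1) * (1 / w j))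
      ≤ 4 * a i ^ 2 := by
    intro i
    rw [← Finset.mul_sum]
    have hi := hwp i
    calc _ ≤ a i ^ 2 * w i * (4 * (1 / w i)) := by
          gcongr
          exact schur_sum i n
      _ = 4 * a i ^ 2 := by field_simp
  calc _ ≤ ∑ i ∈ Finset.range n, ∑ j ∈ Finset.range n,
        (a i ^ 2 * w i * (1 / ((i : ℝ) + j + 1) * (1 / w j))
        + a j ^ 2 * w j * (1 / ((j : ℝ) + i + 1) * (1 / w i))) / 2 :=
        Finset.sum_le_sum fun i _ => Finset.sum_le_sum fun j _ => key i j
    _ = ∑ i ∈ Finset.range n, ∑ j ∈ Finset.range n,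
        a i ^ 2 * w i * (1 / ((i : ℝ) + j + 1) * (1 / w j)) := by
        simp_rw [add_div, Finset.sum_add_distrib]
        rw [Finset.sum_comm (f := fun i j : ℕ =>
          a j ^ 2 * w j * (1 / ((j : ℝ) + i + 1) * (1 / w i)) / 2)]
        simp_rw [← Finset.sum_div]
        ring
    _ ≤ ∑ i ∈ Finset.range n, 4 * a i ^ 2 := Finset.sum_le_sum fun i _ => row i
    _ = _ := by rw [Finset.mul_sum]

theorem sum_moment_sq_le (z : L2) (n : ℕ) :
    ∑ j ∈ Finset.range n, moment z j ^ 2 ≤ 4 * ‖z‖ ^ 2 := by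
  set S := ∑ j ∈ Finset.range n, moment z j ^ 2 with hS
  set p : L2 := ∑ j ∈ Finset.range n, moment z j • monomialL2 j with hp
  have h1 : S = inner ℝ p z := by
    rw [hp, sum_inner]
    refine Finset.sum_congr rfl fun j _ => ?_
    rw [real_inner_smul_left, ← moment_eq_inner, sq]
  have h2 : ‖p‖ ^ 2 ≤ 4 * S := by
    rw [← real_inner_self_eq_norm_sq, hp, sum_inner]
    simp_rw [inner_sum, real_inner_smul_left, real_inner_smul_right, inner_monomialL2]
    refine le_trans (le_of_eq ?_) (hilbert_form_le (moment z) n)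
    refine Finset.sum_congr rfl fun i _ => Finset.sum_congr rfl fun j _ => ?_
    ring
  have h0 : 0 ≤ S := Finset.sum_nonneg fun _ _ => sq_nonneg _
  have h3 : S ≤ ‖p‖ * ‖z‖ := h1 ▸ real_inner_le_norm p z
  have h4 : S * S ≤ 4 * ‖z‖ ^ 2 * S := by
    calc S * S ≤ (‖p‖ * ‖z‖) * (‖p‖ * ‖z‖) := by gcongr
      _ = ‖p‖ ^ 2 * ‖z‖ ^ 2 := by ring
      _ ≤ 4 * S * ‖z‖ ^ 2 := by gcongr
      _ = _ := by ring
  rcases h0.eq_or_lt with h | h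
  · rw [← h]; positivity
  · exact le_of_mul_le_mul_right h4 h

theorem memℓp_moment (z : L2) : Memℓp (moment z) 2 := by
  refine memℓp_gen ?_
  refine summable_of_sum_range_le (c := 4 * ‖z‖ ^ 2) (fun _ => by positivity) fun n => ?_
  simpa using sum_moment_sq_le z n

/-- The Hausdorff moment operator `B : L²(0,1) → ℓ²`, `[B z]_j = ∫₀¹ t ^ j z(t) dt` for
`j = 0, 1, 2, …` (that is, `∫₀¹ t ^ (j - 1) z(t) dt` for `j = 1, 2, …`). -/
def hausdorffOp : L2 →L[ℝ] SeqL2 :=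
  LinearMap.mkContinuous
    { toFun := fun z => ⟨moment z, memℓp_moment z⟩
      map_add' := fun x y => by
        ext j
        change moment (x + y) j = moment x j + moment y j
        simp only [moment_eq_inner, inner_add_right]
      map_smul' := fun c x => by
        ext j
        change moment (c • x) j = c * moment x j
        simp only [moment_eq_inner, real_inner_smul_right] }
    2 fun z => by
      refine lp.norm_le_of_tsum_le (by norm_num) (by positivity) ?_
      have : (2 * ‖z‖) ^ (2 : ENNReal).toReal = 4 * ‖z‖ ^ 2 := by
        simp; ring
      rw [this]
      refine Real.tsum_le_of_sum_range_le (fun _ => by positivity) fun n => ?_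
      simpa using sum_moment_sq_le z n

@[simp] theorem hausdorffOp_apply (z : L2) (j : ℕ) :
    hausdorffOp z j = ∫ t in Set.Ioo (0 : ℝ) 1, t ^ j * z t := rfl

/-! ### The integration operator -/

theorem integrable_L2 (x : L2) : Integrable x unitMeasure :=
  (Lp.memLp x).integrable one_le_two

/-- The primitive `s ↦ ∫₀ˢ x(t) dt`. -/
def primitive (x : L2) (s : ℝ) : ℝ := ∫ t in (0 : ℝ)..s, x t

theorem primitive_eq_inner (x : L2) {s : ℝ} (hs : s ∈ Set.Ioo (0 : ℝ) 1) :
    primitive x s = ∫ t in Set.Ioc (0 : ℝ) s, x t ∂unitMeasure := by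
  rw [primitive, intervalIntegral.integral_of_le hs.1.le,
    Measure.restrict_restrict measurableSet_Ioc]
  congr 2
  ext t
  simp only [Set.mem_Ioc, Set.mem_inter_iff, Set.mem_Ioo]
  constructor
  · rintro ⟨h1, h2⟩
    exact ⟨⟨h1, h2⟩, h1, h2.trans_lt hs.2⟩
  · exact fun h => h.1

theorem integral_norm_le (x : L2) : ∫ t, ‖x t‖ ∂unitMeasure ≤ ‖x‖ := by
  have h := eLpNorm_le_eLpNorm_mul_rpow_measure_univ (p := 1) (q := 2) one_le_two
    (Lp.memLp x).1
  rw [integral_norm_eq_lintegral_enorm (Lp.memLp x).1, Lp.norm_def]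
  refine ENNReal.toReal_mono (Lp.memLp x).2.ne ?_
  rw [← eLpNorm_one_eq_lintegral_enorm]
  simpa using h

theorem abs_primitive_le (x : L2) {s : ℝ} (hs : s ∈ Set.Ioo (0 : ℝ) 1) :
    ‖primitive x s‖ ≤ ‖x‖ := by
  rw [primitive_eq_inner x hs]
  refine (norm_integral_le_integral_norm _).trans (le_trans ?_ (integral_norm_le x))
  exact setIntegral_le_integral (integrable_L2 x).norm (ae_of_all _ fun _ => norm_nonneg _)

theorem memLp_primitive (x : L2) : MemLp (primitive x) 2 unitMeasure := by
  refine MemLp.of_bound ?_ ‖x‖ ?_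
  · have hc : ContinuousOn (primitive x) (Set.Icc 0 1) := by
      have hi : IntegrableOn x (Set.uIcc (0 : ℝ) 1) volume := by
        rw [Set.uIcc_of_le zero_le_one, integrableOn_Icc_iff_integrableOn_Ioo]
        exact integrable_L2 x
      have h := intervalIntegral.continuousOn_primitive_interval hi
      rwa [Set.uIcc_of_le zero_le_one] at h
    exact (hc.mono Set.Ioo_subset_Icc_self).aestronglyMeasurable measurableSet_Ioo
  · filter_upwards [ae_restrict_mem measurableSet_Ioo] with s hs
    exact abs_primitive_le x hs

/-- The integration operator `J : L²(0,1) → L²(0,1)`, `[J x](s) = ∫₀ˢ x(t) dt`. -/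
def integrationOp : L2 →L[ℝ] L2 :=
  LinearMap.mkContinuous
    { toFun := fun x => (memLp_primitive x).toLp (primitive x)
      map_add' := fun x y => by
        rw [← MemLp.toLp_add]
        refine MemLp.toLp_congr _ _ ?_
        filter_upwards [ae_restrict_mem measurableSet_Ioo] with s hs
        rw [Pi.add_apply, primitive_eq_inner _ hs, primitive_eq_inner _ hs,
          primitive_eq_inner _ hs, ← integral_add (integrable_L2 x).restrict
            (integrable_L2 y).restrict]
        exact integral_congr_ae (ae_restrict_of_ae (Lp.coeFn_add x y))
      map_smul' := fun c x => by
        rw [RingHom.id_apply, ← MemLp.toLp_const_smul]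
        refine MemLp.toLp_congr _ _ ?_
        filter_upwards [ae_restrict_mem measurableSet_Ioo] with s hs
        rw [Pi.smul_apply, primitive_eq_inner _ hs, primitive_eq_inner _ hs, ← integral_smul]
        exact integral_congr_ae (ae_restrict_of_ae (Lp.coeFn_smul c x)) }
    1 fun x => by
      have h := Lp.norm_le_of_ae_bound (f := (memLp_primitive x).toLp (primitive x))
        (C := ‖x‖) (norm_nonneg x) (by
          filter_upwards [ae_restrict_mem measurableSet_Ioo, (memLp_primitive x).coeFn_toLp]
            with s hs h
          rw [h]
          exact abs_primitive_le x hs)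
      simpa [measureUnivNNReal] using h

theorem integrationOp_ae (x : L2) :
    integrationOp x =ᵐ[unitMeasure] fun s => ∫ t in (0 : ℝ)..s, x t :=
  (memLp_primitive x).coeFn_toLp

/-! ### Sobolev spaces -/

/-- Test functions on `(0,1)`: smooth with compact support contained in `(0,1)`. -/
def IsTestFunction (φ : ℝ → ℝ) : Prop :=
  ContDiff ℝ ∞ φ ∧ HasCompactSupport φ ∧ tsupport φ ⊆ Set.Ioo (0 : ℝ) 1

/-- `v` is the weak derivative of order `j` of `u` on `(0,1)`. -/
def IsWeakDeriv (j : ℕ) (u v : L2) : Prop :=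
  ∀ φ : ℝ → ℝ, IsTestFunction φ →
    ∫ t in Set.Ioo (0 : ℝ) 1, u t * iteratedDeriv j φ t
      = (-1) ^ j * ∫ t in Set.Ioo (0 : ℝ) 1, v t * φ t

theorem IsTestFunction.memLp_iteratedDeriv {φ : ℝ → ℝ} (hφ : IsTestFunction φ) (j : ℕ) :
    MemLp (iteratedDeriv j φ) 2 unitMeasure := by
  have hc : Continuous (iteratedDeriv j φ) :=
    hφ.1.continuous_iteratedDeriv j (by exact_mod_cast le_top)
  have hs : HasCompactSupport (iteratedDeriv j φ) := by
    have := hφ.2.1.iteratedFDeriv (𝕜 := ℝ) j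
    refine this.mono' (subset_trans ?_ subset_closure)
    intro t ht h0
    refine ht ?_
    rw [iteratedDeriv_eq_iteratedFDeriv, h0]
    rfl
  exact (hc.memLp_of_hasCompactSupport hs).restrict _

theorem IsTestFunction.integrable_mul {φ : ℝ → ℝ} (hφ : IsTestFunction φ) (j : ℕ) (u : L2) :
    Integrable (fun t => u t * iteratedDeriv j φ t) unitMeasure :=
  (Lp.memLp u).integrable_mul (hφ.memLp_iteratedDeriv j)

theorem IsTestFunction.integral_add {φ : ℝ → ℝ} (hφ : IsTestFunction φ) (j : ℕ) (u v : L2) :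
    ∫ t in Set.Ioo (0 : ℝ) 1, (u + v : L2) t * iteratedDeriv j φ t
      = (∫ t in Set.Ioo (0 : ℝ) 1, u t * iteratedDeriv j φ t)
        + ∫ t in Set.Ioo (0 : ℝ) 1, v t * iteratedDeriv j φ t := by
  rw [← MeasureTheory.integral_add (hφ.integrable_mul j u) (hφ.integrable_mul j v)]
  refine integral_congr_ae ?_
  filter_upwards [Lp.coeFn_add u v] with t ht
  rw [ht, Pi.add_apply, add_mul]

theorem IsTestFunction.integral_smul {φ : ℝ → ℝ} (j : ℕ) (c : ℝ) (u : L2) :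
    ∫ t in Set.Ioo (0 : ℝ) 1, (c • u : L2) t * iteratedDeriv j φ t
      = c * ∫ t in Set.Ioo (0 : ℝ) 1, u t * iteratedDeriv j φ t := by
  rw [← integral_const_mul]
  refine integral_congr_ae ?_
  filter_upwards [Lp.coeFn_smul c u] with t ht
  rw [ht, Pi.smul_apply, smul_eq_mul, mul_assoc]

theorem IsWeakDeriv.zero (j : ℕ) : IsWeakDeriv j 0 0 := by
  intro φ _
  have h : ∀ ψ : ℝ → ℝ, ∫ t in Set.Ioo (0 : ℝ) 1, (0 : L2) t * ψ t = 0 := by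
    intro ψ
    refine integral_eq_zero_of_ae ?_
    filter_upwards [Lp.coeFn_zero ℝ 2 unitMeasure] with t ht
    rw [ht, Pi.zero_apply, zero_mul]
  rw [h, h, mul_zero]

theorem IsWeakDeriv.add {j : ℕ} {u₁ v₁ u₂ v₂ : L2} (h₁ : IsWeakDeriv j u₁ v₁)
    (h₂ : IsWeakDeriv j u₂ v₂) : IsWeakDeriv j (u₁ + u₂) (v₁ + v₂) := by
  intro φ hφ
  have h0 := hφ.integral_add 0 v₁ v₂
  simp only [iteratedDeriv_zero] at h0
  rw [hφ.integral_add, h0, h₁ φ hφ, h₂ φ hφ, mul_add]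

theorem IsWeakDeriv.smul {j : ℕ} {u v : L2} (c : ℝ) (h : IsWeakDeriv j u v) :
    IsWeakDeriv j (c • u) (c • v) := by
  intro φ hφ
  have h0 := IsTestFunction.integral_smul (φ := φ) 0 c v
  simp only [iteratedDeriv_zero] at h0
  rw [IsTestFunction.integral_smul, h0, h φ hφ]
  ring

/-- The Sobolev space `H^k(0,1)`. A function `x ∈ L²(0,1)` whose weak derivatives up to order `k`
all lie in `L²(0,1)` is recorded as the tuple `(x, x', …, x^(k))`, which it determines; the norm
inherited from the `ℓ²`-sum is `‖x‖² = ∑_{j ≤ k} ‖x^(j)‖²`. -/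
def sobolev (k : ℕ) : Submodule ℝ (PiLp 2 fun _ : Fin (k + 1) => L2) where
  carrier := {u | ∀ j : Fin (k + 1), IsWeakDeriv j (u 0) (u j)}
  zero_mem' := fun j => IsWeakDeriv.zero j
  add_mem' := fun hu hv j => (hu j).add (hv j)
  smul_mem' := fun c _ hu j => (hu j).smul c

/-- The natural embedding of `H^k(0,1)` into `L²(0,1)`. -/
def sobolevEmbedding (k : ℕ) : sobolev k →L[ℝ] L2 :=
  (PiLp.proj 2 (fun _ : Fin (k + 1) => L2) 0).comp (sobolev k).subtypeL

theorem IsWeakDeriv.unique {j : ℕ} {u v w : L2} (hv : IsWeakDeriv j u v)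
    (hw : IsWeakDeriv j u w) : v = w := by
  have hloc : LocallyIntegrableOn (fun t => v t - w t) (Set.Ioo (0 : ℝ) 1) volume :=
    IntegrableOn.locallyIntegrableOn ((integrable_L2 v).sub (integrable_L2 w))
  have h := isOpen_Ioo.ae_eq_zero_of_integral_contDiff_smul_eq_zero hloc ?_
  · refine Lp.ext ((ae_restrict_iff' measurableSet_Ioo).2 ?_)
    filter_upwards [h] with t ht hmem
    linarith [ht hmem]
  · intro φ h1 h2 h3
    have hφ : IsTestFunction φ := ⟨h1, h2, h3⟩
    have iv := hφ.integrable_mul 0 v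
    have iw := hφ.integrable_mul 0 w
    simp only [iteratedDeriv_zero] at iv iw
    have e := (hv φ hφ).symm.trans (hw φ hφ)
    have e' := mul_left_cancel₀ (pow_ne_zero j (by norm_num : (-1 : ℝ) ≠ 0)) e
    have hsub : ∫ t in Set.Ioo (0 : ℝ) 1, φ t • (v t - w t) = 0 := by
      have : ∀ t, φ t • (v t - w t) = v t * φ t - w t * φ t := fun t => by
        simp only [smul_eq_mul]; ring
      simp_rw [this]
      rw [integral_sub iv iw, e', sub_self]
    rw [← hsub, setIntegral_eq_integral_of_forall_compl_eq_zero]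
    intro t ht
    have : φ t = 0 := by
      by_contra hne
      exact ht (h3 (subset_tsupport φ hne))
    simp [this]

theorem sobolevEmbedding_injective (k : ℕ) : Function.Injective (sobolevEmbedding k) := by
  intro u v h
  have h0 : u.1 0 = v.1 0 := h
  refine Subtype.ext (PiLp.ext fun j => ?_)
  have hv := v.2 j
  rw [← h0] at hv
  exact (u.2 j).unique hv

end HausdorffMoment

end

noncomputable section

namespace HausdorffMoment

open Polynomial

/-! Split `z` at the orthogonal projection Π_n onto polynomials of degree less than n: ‖z‖ ≤ ‖Π_n z‖
+ ‖z - Π_n z‖.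

Moments control the first term, at an exponential price. If Π_n z is the polynomial p, then ‖p‖² =
⟨p, z⟩ is the sum of the coefficients of p times the moments of `z`. Lagrange interpolation of an
antiderivative of p bounds its coefficient sum by e^(4n+1) ‖p‖, so ‖Π_n z‖ ≤ e^(4n+1) δ
(`norm_starProjection_le_hausdorffOp`).

Smoothness controls the second. The Legendre operator -(t(1-t)f')' has form at least n(n+1)‖f‖² on
polynomials orthogonal to those of degree less than n, and at most ‖f'‖²
(`mul_norm_sq_le_legendreForm`, `legendreForm_self_le`). This gives a Jackson inequality with factor
1/n for `J y`. The du Bois-Reymond lemma writes x = c + J x', and iteration gives 1/n^k on H^k.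

With n about ln(1/δ)/8 the exponential term is negligible and n^(-k) is of the required order. -/

/-! ### Polynomials in L²(0,1): moments, density, antiderivatives -/

theorem memLp_eval (p : ℝ[X]) : MemLp (fun t : ℝ => p.eval t) 2 unitMeasure := by
  obtain ⟨C, hC⟩ := (isCompact_Icc (a := (0 : ℝ)) (b := 1)).exists_bound_of_continuousOn
    p.continuous.continuousOn
  refine MemLp.of_bound p.continuous.aestronglyMeasurable C ?_
  filter_upwards [ae_restrict_mem measurableSet_Ioo] with t ht
  exact hC t ⟨ht.1.le, ht.2.le⟩

/-- A polynomial as an element of `L²(0,1)`. -/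
def polyL2 : ℝ[X] →ₗ[ℝ] L2 where
  toFun p := (memLp_eval p).toLp _
  map_add' p q := by
    rw [← MemLp.toLp_add]
    exact MemLp.toLp_congr _ _ (ae_of_all _ fun t => by simp)
  map_smul' c p := by
    rw [RingHom.id_apply, ← MemLp.toLp_const_smul]
    exact MemLp.toLp_congr _ _ (ae_of_all _ fun t => by simp)

theorem polyL2_ae (p : ℝ[X]) : polyL2 p =ᵐ[unitMeasure] fun t => p.eval t :=
  (memLp_eval p).coeFn_toLp

theorem setIntegral_eq_intervalIntegral (f : ℝ → ℝ) :
    ∫ t in Set.Ioo (0 : ℝ) 1, f t = ∫ t in (0 : ℝ)..1, f t := by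
  rw [← integral_Ioc_eq_integral_Ioo, ← intervalIntegral.integral_of_le zero_le_one]

theorem inner_polyL2_left (p : ℝ[X]) (z : L2) :
    inner ℝ (polyL2 p) z = ∫ t in Set.Ioo (0 : ℝ) 1, p.eval t * z t := by
  rw [L2.inner_def]
  refine integral_congr_ae ?_
  filter_upwards [polyL2_ae p] with t ht
  rw [ht]
  simp [mul_comm]

theorem inner_polyL2 (p q : ℝ[X]) :
    inner ℝ (polyL2 p) (polyL2 q) = ∫ t in (0 : ℝ)..1, (p * q).eval t := by
  rw [inner_polyL2_left, ← setIntegral_eq_intervalIntegral]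
  refine integral_congr_ae ?_
  filter_upwards [polyL2_ae q] with t ht
  simp only [ht, eval_mul]

theorem polyL2_X_pow (j : ℕ) : polyL2 (X ^ j) = monomialL2 j :=
  MemLp.toLp_congr (memLp_eval _) _ (ae_of_all _ fun t => by simp)

theorem inner_polyL2_eq_sum (p : ℝ[X]) (z : L2) :
    inner ℝ (polyL2 p) z = p.sum fun j a => a * moment z j := by
  conv_lhs => rw [p.as_sum_support]
  rw [map_sum, sum_inner, Polynomial.sum]
  refine Finset.sum_congr rfl fun j _ => ?_
  rw [← C_mul_X_pow_eq_monomial, ← smul_eq_C_mul, map_smul, polyL2_X_pow, real_inner_smul_left,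
    moment_eq_inner]

/-- By Weierstrass approximation, orthogonality to polynomials passes to all continuous functions,
in particular to test functions, and the fundamental lemma of the calculus of variations applies. -/
theorem eq_zero_of_forall_inner_polyL2 {z : L2} (hz : ∀ p, inner ℝ (polyL2 p) z = 0) :
    z = 0 := by
  have hcont : ∀ f : ℝ → ℝ, Continuous f → ∫ t in Set.Ioo (0 : ℝ) 1, f t * z t = 0 := by
    intro f hf
    obtain ⟨M, hM⟩ := (isCompact_Icc (a := (0 : ℝ)) (b := 1)).exists_bound_of_continuousOn
      hf.continuousOn
    have hif : Integrable (fun t => f t * z t) unitMeasure := by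
      refine (integrable_L2 z).bdd_mul (c := M) hf.aestronglyMeasurable ?_
      filter_upwards [ae_restrict_mem measurableSet_Ioo] with t ht
      exact hM t ⟨ht.1.le, ht.2.le⟩
    have key : ∀ ε > 0, |∫ t in Set.Ioo (0 : ℝ) 1, f t * z t| ≤ ε * ‖z‖ := by
      intro ε hε
      obtain ⟨p, hp⟩ := exists_polynomial_near_of_continuousOn 0 1 f hf.continuousOn ε hε
      have hp0 := hz p
      rw [inner_polyL2_left] at hp0
      have hip : Integrable (fun t => p.eval t * z t) unitMeasure :=
        (memLp_eval p).integrable_mul (Lp.memLp z)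
      have e : ∫ t in Set.Ioo (0 : ℝ) 1, f t * z t
          = ∫ t in Set.Ioo (0 : ℝ) 1, (f t * z t - p.eval t * z t) := by
        rw [integral_sub hif hip, hp0, sub_zero]
      rw [e, ← Real.norm_eq_abs]
      refine (norm_integral_le_of_norm_le ((integrable_L2 z).norm.const_mul ε) ?_).trans ?_
      · filter_upwards [ae_restrict_mem measurableSet_Ioo] with t ht
        rw [← sub_mul, norm_mul, Real.norm_eq_abs, abs_sub_comm]
        exact mul_le_mul_of_nonneg_right (hp t ⟨ht.1.le, ht.2.le⟩).le (norm_nonneg _)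
      · rw [integral_const_mul]
        exact mul_le_mul_of_nonneg_left (integral_norm_le z) hε.le
    by_contra hne
    have h1 : 0 < |∫ t in Set.Ioo (0 : ℝ) 1, f t * z t| := abs_pos.2 hne
    -- This ε makes ε‖z‖ smaller than the integral itself; the `+ 1` covers ‖z‖ = 0.
    have h2 := key (|∫ t in Set.Ioo (0 : ℝ) 1, f t * z t| / (2 * (‖z‖ + 1))) (by positivity)
    rw [div_mul_eq_mul_div, le_div_iff₀ (by positivity)] at h2
    nlinarith [norm_nonneg z]
  have h := isOpen_Ioo.ae_eq_zero_of_integral_contDiff_smul_eq_zero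
    (IntegrableOn.locallyIntegrableOn (integrable_L2 z)) (fun φ h1 h2 h3 => ?_)
  · refine Lp.ext ((ae_restrict_iff' measurableSet_Ioo).2 ?_)
    filter_upwards [h, (ae_restrict_iff' measurableSet_Ioo).1 (Lp.coeFn_zero ℝ 2 unitMeasure)]
      with t ht h0 hmem
    rw [ht hmem, h0 hmem, Pi.zero_apply]
  · have := hcont φ h1.continuous
    rw [← this]
    simp_rw [smul_eq_mul]
    rw [setIntegral_eq_integral_of_forall_compl_eq_zero]
    intro t ht
    have : φ t = 0 := by
      by_contra hne
      exact ht (h3 (subset_tsupport φ hne))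
    simp [this]

/-- Lets claims about `integrationOp` that are closed conditions be checked on polynomials only,
where calculus is classical. -/
theorem denseRange_polyL2 : DenseRange polyL2 := by
  have h : (LinearMap.range polyL2).topologicalClosure = ⊤ := by
    rw [Submodule.topologicalClosure_eq_top_iff, Submodule.eq_bot_iff]
    intro z hz
    exact eq_zero_of_forall_inner_polyL2 fun p =>
      Submodule.inner_right_of_mem_orthogonal (LinearMap.mem_range_self _ p) hz
  have := (Submodule.dense_iff_topologicalClosure_eq_top).2 h
  rwa [LinearMap.coe_range] at this

theorem intervalIntegral_derivative (F : ℝ[X]) (a b : ℝ) :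
    ∫ t in a..b, (derivative F).eval t = F.eval b - F.eval a :=
  intervalIntegral.integral_eq_sub_of_hasDerivAt (fun t _ => F.hasDerivAt t)
    ((derivative F).continuous.intervalIntegrable _ _)

theorem exists_antiderivative (p : ℝ[X]) : ∃ P : ℝ[X], derivative P = p ∧ P.coeff 0 = 0 := by
  induction p using Polynomial.induction_on' with
  | add p q hp hq =>
    obtain ⟨P, hP, hP0⟩ := hp
    obtain ⟨Q, hQ, hQ0⟩ := hq
    exact ⟨P + Q, by rw [derivative_add, hP, hQ], by rw [coeff_add, hP0, hQ0, add_zero]⟩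
  | monomial n a =>
    refine ⟨monomial (n + 1) (a / (n + 1)), ?_, by simp [coeff_monomial]⟩
    rw [derivative_monomial]
    congr 1
    have : (n : ℝ) + 1 ≠ 0 := by positivity
    push_cast
    field_simp

theorem primitive_polyL2 {P : ℝ[X]} (hP : P.coeff 0 = 0) {s : ℝ} (hs : s ∈ Set.Ioo (0 : ℝ) 1) :
    primitive (polyL2 (derivative P)) s = P.eval s := by
  have h : primitive (polyL2 (derivative P)) s = ∫ t in (0 : ℝ)..s, (derivative P).eval t := by
    rw [primitive]
    refine intervalIntegral.integral_congr_ae ?_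
    filter_upwards [(ae_restrict_iff' measurableSet_Ioo).1 (polyL2_ae (derivative P))]
      with t ht hmem
    rw [Set.uIoc_of_le hs.1.le] at hmem
    exact ht ⟨hmem.1, hmem.2.trans_lt hs.2⟩
  rw [h, intervalIntegral_derivative, ← coeff_zero_eq_eval_zero, hP, sub_zero]

theorem integrationOp_polyL2 {P : ℝ[X]} (hP : P.coeff 0 = 0) :
    integrationOp (polyL2 (derivative P)) = polyL2 P := by
  refine Lp.ext ?_
  filter_upwards [integrationOp_ae (polyL2 (derivative P)), polyL2_ae P,
    ae_restrict_mem measurableSet_Ioo] with s h1 h2 hs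
  rw [h1, h2]
  exact primitive_polyL2 hP hs

/-! ### Subspaces of polynomials of bounded degree -/

/-- The polynomials of degree less than `n`, as a subspace of `L²(0,1)`. -/
def polySubspace (n : ℕ) : Submodule ℝ L2 := (degreeLT ℝ n).map polyL2

instance (n : ℕ) : FiniteDimensional ℝ (polySubspace n) := by
  have : Module.Finite ℝ (degreeLT ℝ n) := Module.Finite.equiv (degreeLTEquiv ℝ n).symm
  unfold polySubspace
  infer_instance

theorem polySubspace_mono {m n : ℕ} (h : m ≤ n) : polySubspace m ≤ polySubspace n :=
  Submodule.map_mono (degreeLT_mono h)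

theorem mem_degreeLT_succ_of_derivative {P : ℝ[X]} {n : ℕ} (h : derivative P ∈ degreeLT ℝ n) :
    P ∈ degreeLT ℝ (n + 1) := by
  rw [mem_degreeLT, degree_lt_iff_coeff_zero] at *
  intro m hm
  obtain ⟨m, rfl⟩ : ∃ l, m = l + 1 := ⟨m - 1, by omega⟩
  have := h m (by omega)
  rw [coeff_derivative] at this
  exact (mul_eq_zero.1 this).resolve_right (by positivity)

theorem integrationOp_mem_polySubspace {n : ℕ} {y : L2} (hy : y ∈ polySubspace n) :
    integrationOp y ∈ polySubspace (n + 1) := by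
  obtain ⟨p, hp, rfl⟩ := hy
  obtain ⟨P, rfl, hP0⟩ := exists_antiderivative p
  rw [integrationOp_polyL2 hP0]
  exact ⟨P, mem_degreeLT_succ_of_derivative hp, rfl⟩

/-! ### The Legendre operator and Jackson's inequality -/

/-- The Legendre differential operator `f ↦ -(t (1 - t) f')'` on polynomials. -/
def legendreOp (f : ℝ[X]) : ℝ[X] := -derivative (X * ((1 - X) * derivative f))

/-- The bilinear form `∫₀¹ t (1 - t) f'(t) g'(t) dt` of the Legendre operator. -/
def legendreForm (f g : ℝ[X]) : ℝ :=
  ∫ t in (0 : ℝ)..1, (X * ((1 - X) * (derivative f * derivative g))).eval t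

theorem intervalIntegrable_eval (p : ℝ[X]) (a b : ℝ) :
    IntervalIntegrable (fun t => p.eval t) volume a b :=
  p.continuous.intervalIntegrable _ _

/-- Integration by parts; the weight t(1-t) vanishes at both endpoints, so no boundary conditions on
`f` or `g` are needed. -/
theorem inner_legendreOp (f g : ℝ[X]) :
    inner ℝ (polyL2 (legendreOp f)) (polyL2 g) = legendreForm f g := by
  have h := intervalIntegral_derivative (X * ((1 - X) * derivative f) * g) 0 1
  rw [inner_polyL2, legendreForm, ← sub_eq_zero, ← intervalIntegral.integral_sub
    (intervalIntegrable_eval _ _ _) (intervalIntegrable_eval _ _ _)]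
  simp only [eval_mul, eval_X, zero_mul, eval_sub, eval_one, sub_self, mul_zero] at h
  rw [← neg_eq_zero, ← intervalIntegral.integral_neg, ← h]
  congr 1
  ext t
  rw [← eval_sub, ← eval_neg]
  congr 1
  rw [legendreOp, derivative_mul (f := X * ((1 - X) * derivative f))]
  ring

theorem legendreForm_comm (f g : ℝ[X]) : legendreForm f g = legendreForm g f := by
  rw [legendreForm, legendreForm, mul_comm (derivative f)]

theorem legendreForm_add_self (f g : ℝ[X]) :
    legendreForm (f + g) (f + g) = legendreForm f f + 2 * legendreForm f g + legendreForm g g := by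
  have add_right : ∀ a b c, legendreForm a (b + c) = legendreForm a b + legendreForm a c := by
    intro a b c
    rw [← inner_legendreOp, ← inner_legendreOp, ← inner_legendreOp, map_add, inner_add_right]
  rw [add_right, legendreForm_comm, add_right, legendreForm_comm (f + g), add_right,
    legendreForm_comm g f]
  ring

theorem legendreForm_self_nonneg (f : ℝ[X]) : 0 ≤ legendreForm f f := by
  refine intervalIntegral.integral_nonneg zero_le_one fun t ht => ?_
  simp only [eval_mul, eval_X, eval_sub, eval_one]
  exact mul_nonneg ht.1 (mul_nonneg (sub_nonneg.2 ht.2) (mul_self_nonneg _))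

theorem legendreForm_self_le (f : ℝ[X]) :
    legendreForm f f ≤ ‖polyL2 (derivative f)‖ ^ 2 := by
  rw [← real_inner_self_eq_norm_sq, inner_polyL2]
  refine intervalIntegral.integral_mono_on zero_le_one (intervalIntegrable_eval _ _ _)
    (intervalIntegrable_eval _ _ _) fun t ht => ?_
  simp only [eval_mul, eval_X, eval_sub, eval_one]
  rw [← mul_assoc]
  refine mul_le_of_le_one_left (mul_self_nonneg _) ?_
  nlinarith [ht.1, ht.2]

theorem coeff_legendreOp (f : ℝ[X]) (j : ℕ) :
    (legendreOp f).coeff j = j * (j + 1) * f.coeff j - (j + 1) ^ 2 * f.coeff (j + 1) := by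
  rw [legendreOp, coeff_neg, coeff_derivative, coeff_X_mul, sub_mul, one_mul, coeff_sub,
    coeff_derivative]
  cases j with
  | zero => simp
  | succ j =>
    rw [coeff_X_mul, coeff_derivative]
    push_cast
    ring

theorem legendreOp_mem_degreeLT {f : ℝ[X]} {n : ℕ} (hf : f ∈ degreeLT ℝ n) :
    legendreOp f ∈ degreeLT ℝ n := by
  rw [mem_degreeLT, degree_lt_iff_coeff_zero] at *
  intro m hm
  rw [coeff_legendreOp, hf m hm, hf (m + 1) (by omega)]
  simp

/-- The operator is triangular on monomials with diagonal entries j(j+1), so the top coefficient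
cancels. -/
theorem legendreOp_sub_mem_degreeLT {f : ℝ[X]} {n : ℕ} (hf : f ∈ degreeLT ℝ (n + 1)) :
    legendreOp f - ((n : ℝ) * (n + 1)) • f ∈ degreeLT ℝ n := by
  rw [mem_degreeLT, degree_lt_iff_coeff_zero] at *
  intro m hm
  rw [coeff_sub, coeff_smul, coeff_legendreOp, hf (m + 1) (by omega)]
  rcases hm.eq_or_lt with rfl | h
  · simp
  · simp [hf m h]

theorem polyL2_mem_polySubspace {f : ℝ[X]} {n : ℕ} (hf : f ∈ degreeLT ℝ n) :
    polyL2 f ∈ polySubspace n :=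
  Submodule.mem_map_of_mem hf

theorem exists_polyL2_eq_starProjection (f : ℝ[X]) (n : ℕ) :
    ∃ q ∈ degreeLT ℝ n, polyL2 q = (polySubspace n).starProjection (polyL2 f) :=
  Submodule.mem_map.1 (Submodule.starProjection_apply_mem (polySubspace n) (polyL2 f))

/-- A spectral gap obtained without Legendre polynomials. Induction on the degree bound peels off
the part `e` of `r` orthogonal to degree less than `N`. Modulo lower degree, `e` is an eigenvector
for N(N+1) ≥ n(n+1), and it is orthogonal to the rest for the form too, since the operator does not
raise degrees. -/
theorem mul_norm_sq_le_legendreForm {n N : ℕ} {r : ℝ[X]} (hr : r ∈ degreeLT ℝ N)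
    (horth : polyL2 r ∈ (polySubspace n)ᗮ) :
    (n : ℝ) * (n + 1) * ‖polyL2 r‖ ^ 2 ≤ legendreForm r r := by
  induction N generalizing r with
  | zero =>
    have : r = 0 := by simpa [mem_degreeLT] using hr
    simp [this, legendreForm]
  | succ N ih =>
    rcases lt_or_ge N n with hlt | hge
    -- Here `r` lies both in `polySubspace n` and in its orthogonal complement, so its norm is zero.
    · have h0 := Submodule.inner_right_of_mem_orthogonal
        (polyL2_mem_polySubspace (degreeLT_mono (Nat.succ_le_of_lt hlt) hr)) horth
      rw [real_inner_self_eq_norm_sq] at h0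
      rw [h0, mul_zero]
      exact legendreForm_self_nonneg r
    obtain ⟨q, hq, hqe⟩ := exists_polyL2_eq_starProjection r N
    set e := r - q with he
    have hee : polyL2 e ∈ (polySubspace N)ᗮ := by
      rw [he, map_sub, hqe]
      exact Submodule.sub_starProjection_mem_orthogonal _
    have heN : e ∈ degreeLT ℝ (N + 1) :=
      Submodule.sub_mem _ hr (degreeLT_mono (Nat.le_succ N) hq)
    have hqo : polyL2 q ∈ (polySubspace n)ᗮ := by
      have : polyL2 q = polyL2 r - polyL2 e := by rw [he, map_sub, sub_sub_cancel]
      rw [this]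
      exact Submodule.sub_mem _ horth (Submodule.orthogonal_le (polySubspace_mono hge) hee)
    have hr' : r = q + e := by rw [he]; ring
    have hcross : legendreForm q e = 0 := by
      rw [← inner_legendreOp]
      exact Submodule.inner_right_of_mem_orthogonal
        (polyL2_mem_polySubspace (legendreOp_mem_degreeLT hq)) hee
    have hself : legendreForm e e = (N : ℝ) * (N + 1) * ‖polyL2 e‖ ^ 2 := by
      have h := Submodule.inner_right_of_mem_orthogonal
        (polyL2_mem_polySubspace (legendreOp_sub_mem_degreeLT heN)) hee
      rw [map_sub, map_smul, inner_sub_left, real_inner_smul_left, inner_legendreOp,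
        real_inner_self_eq_norm_sq] at h
      linarith
    have hnorm : ‖polyL2 r‖ ^ 2 = ‖polyL2 q‖ ^ 2 + ‖polyL2 e‖ ^ 2 := by
      have h := Submodule.inner_right_of_mem_orthogonal (polyL2_mem_polySubspace hq) hee
      rw [hr', map_add, norm_add_sq_real, h]
      ring
    have hnN : (n : ℝ) ≤ N := by exact_mod_cast hge
    have := ih hq hqo
    have h2 : (n : ℝ) * (n + 1) * ‖polyL2 e‖ ^ 2 ≤ (N : ℝ) * (N + 1) * ‖polyL2 e‖ ^ 2 := by
      gcongr
    rw [hnorm]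
    nth_rw 2 [hr']
    rw [hr', legendreForm_add_self, hcross, hself]
    linarith

/-- The projection `q` and the remainder are orthogonal for the Legendre form, so the remainder has
form at most that of `f`, hence at most ‖f'‖². The gap bounds it below by n(n+1) ≥ n² times its
squared norm. -/
theorem norm_polyL2_sub_starProjection_le (f : ℝ[X]) (n : ℕ) :
    n * ‖polyL2 f - (polySubspace n).starProjection (polyL2 f)‖ ≤ ‖polyL2 (derivative f)‖ := by
  obtain ⟨q, hq, hqe⟩ := exists_polyL2_eq_starProjection f n
  rw [← hqe, ← map_sub]
  have ho : polyL2 (f - q) ∈ (polySubspace n)ᗮ := by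
    rw [map_sub, hqe]
    exact Submodule.sub_starProjection_mem_orthogonal _
  have hmem : f - q ∈ degreeLT ℝ ((f - q).natDegree + 1) := by
    rw [mem_degreeLT]
    exact lt_of_le_of_lt degree_le_natDegree (by exact_mod_cast Nat.lt_succ_self _)
  have h1 := mul_norm_sq_le_legendreForm hmem ho
  have hcross : legendreForm q (f - q) = 0 := by
    rw [← inner_legendreOp]
    exact Submodule.inner_right_of_mem_orthogonal
      (polyL2_mem_polySubspace (legendreOp_mem_degreeLT hq)) ho
  have h2 := legendreForm_add_self q (f - q)
  rw [add_sub_cancel, hcross] at h2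
  have h3 := legendreForm_self_nonneg q
  have h4 := legendreForm_self_le f
  refine le_of_sq_le_sq ?_ (norm_nonneg _)
  have h5 : 0 ≤ (n : ℝ) * ‖polyL2 (f - q)‖ ^ 2 := by positivity
  nlinarith

/-- Jackson's inequality for primitives of square integrable functions. -/
theorem norm_integrationOp_sub_starProjection_le (y : L2) (n : ℕ) :
    n * ‖integrationOp y - (polySubspace n).starProjection (integrationOp y)‖ ≤ ‖y‖ := by
  refine denseRange_polyL2.induction_on (p := fun y => n * ‖integrationOp y -
    (polySubspace n).starProjection (integrationOp y)‖ ≤ ‖y‖) y ?_ fun p => ?_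
  · exact isClosed_le (by fun_prop) continuous_norm
  · obtain ⟨P, rfl, hP⟩ := exists_antiderivative p
    rw [integrationOp_polyL2 hP]
    exact norm_polyL2_sub_starProjection_le P n

/-- Integrating Π_n y stays polynomial and raises the degree by one, so only J(y - Π_n y)
contributes to the error. -/
theorem norm_add_integrationOp_sub_starProjection_le (c : ℝ) (y : L2) (n : ℕ) :
    (n + 1) * ‖polyL2 (C c) + integrationOp y
        - (polySubspace (n + 1)).starProjection (polyL2 (C c) + integrationOp y)‖
      ≤ ‖y - (polySubspace n).starProjection y‖ := by
  set w := (polySubspace n).starProjection y with hw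
  have hmem : polyL2 (C c) + integrationOp w ∈ polySubspace (n + 1) := by
    refine Submodule.add_mem _ (polyL2_mem_polySubspace ?_)
      (integrationOp_mem_polySubspace (Submodule.starProjection_apply_mem _ _))
    rw [mem_degreeLT]
    exact degree_C_le.trans_lt (by exact_mod_cast Nat.succ_pos n)
  have h := norm_integrationOp_sub_starProjection_le (y - w) (n + 1)
  have e : polyL2 (C c) + integrationOp y
      = polyL2 (C c) + integrationOp w + integrationOp (y - w) := by
    rw [map_sub]; abel
  rw [e, map_add _ (polyL2 (C c) + integrationOp w),
    Submodule.starProjection_eq_self_iff.2 hmem, add_sub_add_left_eq_sub]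
  exact_mod_cast h

/-! ### Weak derivatives and primitives -/

theorem IsTestFunction.deriv {φ : ℝ → ℝ} (hφ : IsTestFunction φ) : IsTestFunction (deriv φ) :=
  ⟨(contDiff_infty_iff_deriv.1 hφ.1).2, hφ.2.1.deriv,
    tsupport_deriv_subset.trans hφ.2.2⟩

theorem IsTestFunction.eq_zero_of_notMem {φ : ℝ → ℝ} (hφ : IsTestFunction φ) {t : ℝ}
    (ht : t ∉ Set.Ioo (0 : ℝ) 1) : φ t = 0 :=
  image_eq_zero_of_notMem_tsupport fun h => ht (hφ.2.2 h)

theorem IsTestFunction.memLp {φ : ℝ → ℝ} (hφ : IsTestFunction φ) : MemLp φ 2 unitMeasure := by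
  simpa using hφ.memLp_iteratedDeriv 0

/-- The antiderivative of a test function of mean zero is a test function. -/
theorem IsTestFunction.exists_deriv_eq {η : ℝ → ℝ} (hη : IsTestFunction η)
    (h0 : ∫ t in (0 : ℝ)..1, η t = 0) : ∃ φ, IsTestFunction φ ∧ _root_.deriv φ = η := by
  have hc : Continuous η := hη.1.continuous
  set φ : ℝ → ℝ := fun s => ∫ t in (0 : ℝ)..s, η t with hφ
  have hd : ∀ s, HasDerivAt φ (η s) s := fun s =>
    intervalIntegral.integral_hasDerivAt_right (hc.intervalIntegrable _ _)
      (hc.stronglyMeasurableAtFilter _ _) hc.continuousAt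
  have hde : _root_.deriv φ = η := funext fun s => (hd s).deriv
  obtain ⟨a, b, ha, hb, hab⟩ : ∃ a b : ℝ, 0 < a ∧ b < 1 ∧ tsupport η ⊆ Set.Icc a b := by
    rcases (tsupport η).eq_empty_or_nonempty with he | hne
    · exact ⟨1, 0, one_pos, zero_lt_one, by simp [he]⟩
    · obtain ⟨a, ha⟩ := IsCompact.exists_isLeast hη.2.1 hne
      obtain ⟨b, hb⟩ := IsCompact.exists_isGreatest hη.2.1 hne
      exact ⟨a, b, (hη.2.2 ha.1).1, (hη.2.2 hb.1).2, fun t ht => ⟨ha.2 ht, hb.2 ht⟩⟩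
  have hz : ∀ t, t ∉ Set.Icc a b → η t = 0 := fun t ht =>
    image_eq_zero_of_notMem_tsupport fun h => ht (hab h)
  have hsupp : Function.support φ ⊆ Set.Icc a b := by
    intro s hs
    by_contra hns
    refine hs ?_
    rw [Set.mem_Icc, not_and_or, not_le, not_le] at hns
    rcases hns with h | h
    · refine (intervalIntegral.integral_congr fun t ht => ?_).trans intervalIntegral.integral_zero
      refine hz t fun hm => ?_
      rcases Set.mem_uIcc.1 ht with h' | h' <;> linarith [hm.1, h'.1, h'.2]
    -- To the right of the support, vanishing of the primitive is exactly the mean-zero hypothesis.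
    · have h1 : ∫ t in s..1, η t = 0 := by
        refine (intervalIntegral.integral_congr fun t ht => ?_).trans intervalIntegral.integral_zero
        refine hz t fun hm => ?_
        rcases Set.mem_uIcc.1 ht with h' | h' <;> linarith [hm.2, h'.1, h'.2]
      have h2 := intervalIntegral.integral_add_adjacent_intervals
        (hc.intervalIntegrable (μ := volume) 0 s) (hc.intervalIntegrable (μ := volume) s 1)
      rw [h1, h0, add_zero] at h2
      exact h2
  have hts : tsupport φ ⊆ Set.Icc a b := closure_minimal hsupp isClosed_Icc
  refine ⟨φ, ⟨contDiff_infty_iff_deriv.2 ⟨fun s => (hd s).differentiableAt, hde ▸ hη.1⟩,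
    HasCompactSupport.of_support_subset_isCompact isCompact_Icc hsupp, fun t ht => ?_⟩, hde⟩
  exact ⟨ha.trans_le (hts ht).1, (hts ht).2.trans_lt hb⟩

theorem exists_isTestFunction_integral_eq_one :
    ∃ ψ, IsTestFunction ψ ∧ ∫ t in (0 : ℝ)..1, ψ t = 1 := by
  let f : ContDiffBump (1 / 2 : ℝ) := ⟨1 / 8, 1 / 4, by norm_num, by norm_num⟩
  have hs : tsupport f ⊆ Set.Ioo (0 : ℝ) 1 := by
    rw [f.tsupport_eq, Real.closedBall_eq_Icc]
    intro t ht
    change t ∈ Set.Icc ((1 : ℝ) / 2 - 1 / 4) (1 / 2 + 1 / 4) at ht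
    constructor <;> linarith [ht.1, ht.2]
  have hs' : tsupport (f.normed volume) ⊆ Set.Ioo (0 : ℝ) 1 := by
    rwa [f.tsupport_normed_eq, ← f.tsupport_eq]
  have ht : IsTestFunction (f.normed volume) :=
    ⟨f.contDiff_normed, f.hasCompactSupport_normed, hs'⟩
  refine ⟨_, ht, ?_⟩
  rw [← setIntegral_eq_intervalIntegral, setIntegral_eq_integral_of_forall_compl_eq_zero]
  · exact f.integral_normed
  · exact fun t h => ht.eq_zero_of_notMem h

theorem integral_mul_eq_inner {φ : ℝ → ℝ} (hφ : MemLp φ 2 unitMeasure) (z : L2) :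
    ∫ t in Set.Ioo (0 : ℝ) 1, z t * φ t = inner ℝ (hφ.toLp φ) z := by
  rw [L2.inner_def]
  refine integral_congr_ae ?_
  filter_upwards [hφ.coeFn_toLp] with t ht
  rw [ht]
  simp

/-- Both sides are continuous in `v`, and for polynomial `v` this is ordinary integration by parts.
-/
theorem isWeakDeriv_integrationOp (v : L2) : IsWeakDeriv 1 (integrationOp v) v := by
  intro φ hφ
  rw [iteratedDeriv_one, integral_mul_eq_inner hφ.deriv.memLp, integral_mul_eq_inner hφ.memLp]
  refine denseRange_polyL2.induction_on (p := fun v => inner ℝ (hφ.deriv.memLp.toLp _)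
    (integrationOp v) = (-1) ^ 1 * inner ℝ (hφ.memLp.toLp _) v) v ?_ fun p => ?_
  · exact isClosed_eq (by fun_prop) (by fun_prop)
  · obtain ⟨P, rfl, hP⟩ := exists_antiderivative p
    rw [integrationOp_polyL2 hP, real_inner_comm, inner_polyL2_left, real_inner_comm,
      inner_polyL2_left]
    have e1 : ∫ t in Set.Ioo (0 : ℝ) 1, P.eval t * (hφ.deriv.memLp.toLp (deriv φ)) t
        = ∫ t in (0 : ℝ)..1, P.eval t * deriv φ t := by
      rw [← setIntegral_eq_intervalIntegral]
      refine integral_congr_ae ?_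
      filter_upwards [hφ.deriv.memLp.coeFn_toLp] with t ht
      rw [ht]
    have e2 : ∫ t in Set.Ioo (0 : ℝ) 1, (derivative P).eval t * (hφ.memLp.toLp φ) t
        = ∫ t in (0 : ℝ)..1, (derivative P).eval t * φ t := by
      rw [← setIntegral_eq_intervalIntegral]
      refine integral_congr_ae ?_
      filter_upwards [hφ.memLp.coeFn_toLp] with t ht
      rw [ht]
    rw [e1, e2, intervalIntegral.integral_mul_deriv_eq_deriv_mul (u' := fun t =>
      (derivative P).eval t) (fun t _ => P.hasDerivAt t)
      (fun t _ => ((hφ.1.differentiable (by simp)) t).hasDerivAt)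
      (intervalIntegrable_eval _ _ _) (hφ.deriv.1.continuous.intervalIntegrable _ _),
      hφ.eq_zero_of_notMem (t := 1) (by simp), hφ.eq_zero_of_notMem (t := 0) (by simp)]
    ring

theorem IsTestFunction.sub_smul {φ ψ : ℝ → ℝ} (hφ : IsTestFunction φ) (hψ : IsTestFunction ψ)
    (c : ℝ) : IsTestFunction (fun t => φ t - c * ψ t) := by
  have hs : tsupport (fun t => φ t - c * ψ t) ⊆ tsupport φ ∪ tsupport ψ := by
    refine closure_minimal (fun t ht => ?_)
      ((isClosed_tsupport φ).union (isClosed_tsupport ψ))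
    by_contra h
    rw [Set.mem_union, not_or] at h
    refine ht ?_
    simp [image_eq_zero_of_notMem_tsupport h.1, image_eq_zero_of_notMem_tsupport h.2]
  refine ⟨hφ.1.sub (contDiff_const.mul hψ.1), ?_, hs.trans (Set.union_subset hφ.2.2 hψ.2.2)⟩
  exact (hφ.2.1.isCompact.union hψ.2.1.isCompact).of_isClosed_subset (isClosed_tsupport _) hs

/-- The lemma of du Bois-Reymond. -/
theorem IsWeakDeriv.exists_eq_const {w : L2} (hw : IsWeakDeriv 1 w 0) :
    ∃ c : ℝ, w = polyL2 (C c) := by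
  obtain ⟨ψ, hψ, hψ1⟩ := exists_isTestFunction_integral_eq_one
  have hzero : ∀ φ, IsTestFunction φ → ∫ t in Set.Ioo (0 : ℝ) 1, w t * deriv φ t = 0 := by
    intro φ hφ
    have h := hw φ hφ
    rw [iteratedDeriv_one, integral_mul_eq_inner hφ.memLp, inner_zero_right, mul_zero] at h
    exact h
  have hmean : ∀ φ, IsTestFunction φ → ∫ t in Set.Ioo (0 : ℝ) 1, w t * φ t
      = (∫ t in Set.Ioo (0 : ℝ) 1, w t * ψ t) * ∫ t in (0 : ℝ)..1, φ t := by
    intro φ hφ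
    set m := ∫ t in (0 : ℝ)..1, φ t with hm
    -- Subtracting `m` times the bump of integral one leaves mean zero, hence the derivative of a
    -- test function, which `w` annihilates.
    have hη := hφ.sub_smul hψ m
    have hi : ∀ {θ : ℝ → ℝ}, IsTestFunction θ → Integrable (fun t => w t * θ t) unitMeasure :=
      fun hθ => (Lp.memLp w).integrable_mul hθ.memLp
    obtain ⟨θ, hθ, hθd⟩ := hη.exists_deriv_eq (by
      rw [intervalIntegral.integral_sub (hφ.1.continuous.intervalIntegrable _ _)
        ((hψ.1.continuous.intervalIntegrable _ _).const_mul m),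
        intervalIntegral.integral_const_mul, hψ1, ← hm, mul_one, sub_self])
    have h := hzero θ hθ
    rw [hθd] at h
    have e : ∀ t, w t * (φ t - m * ψ t) = w t * φ t - m * (w t * ψ t) := fun t => by ring
    simp_rw [e] at h
    rw [integral_sub (hi hφ) ((hi hψ).const_mul m), integral_const_mul] at h
    linarith
  refine ⟨∫ t in Set.Ioo (0 : ℝ) 1, w t * ψ t, ?_⟩
  set c := ∫ t in Set.Ioo (0 : ℝ) 1, w t * ψ t with hc
  -- A weak derivative of order zero is the function itself, so uniqueness turns equality against
  -- test functions into equality in L².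
  refine IsWeakDeriv.unique (j := 0) (u := w) (fun φ _ => by simp) fun φ hφ => ?_
  rw [iteratedDeriv_zero, hmean φ hφ, pow_zero, one_mul, ← setIntegral_eq_intervalIntegral,
    ← integral_const_mul]
  refine integral_congr_ae ?_
  filter_upwards [polyL2_ae (C c)] with t ht
  rw [ht, eval_C]

theorem IsWeakDeriv.exists_eq_add_integrationOp {u v : L2} (h : IsWeakDeriv 1 u v) :
    ∃ c : ℝ, u = polyL2 (C c) + integrationOp v := by
  have h' := h.add ((isWeakDeriv_integrationOp v).smul (-1))
  rw [neg_one_smul, neg_one_smul, add_neg_cancel] at h'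
  obtain ⟨c, hc⟩ := h'.exists_eq_const
  exact ⟨c, by rw [← hc]; abel⟩

/-- Test the order-`j` identity with φ'. -/
theorem IsWeakDeriv.of_succ {j : ℕ} {u v w : L2} (hv : IsWeakDeriv j u v)
    (hw : IsWeakDeriv (j + 1) u w) : IsWeakDeriv 1 v w := by
  intro φ hφ
  have h1 := hv (deriv φ) hφ.deriv
  have h2 := hw φ hφ
  rw [iteratedDeriv_succ'] at h2
  rw [h2] at h1
  rw [iteratedDeriv_one]
  have h3 : ((-1 : ℝ) ^ j) * (-1) ^ j = 1 := by rw [← mul_pow]; simp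
  calc _ = ((-1 : ℝ) ^ j * (-1) ^ j) * ∫ t in Set.Ioo (0 : ℝ) 1, v t * deriv φ t := by
        rw [h3, one_mul]
    _ = (-1) ^ j * ((-1) ^ (j + 1) * ∫ t in Set.Ioo (0 : ℝ) 1, w t * φ t) := by
        rw [mul_assoc, ← h1]
    _ = ((-1 : ℝ) ^ j * (-1) ^ j) * ((-1) ^ 1 * ∫ t in Set.Ioo (0 : ℝ) 1, w t * φ t) := by ring
    _ = _ := by rw [h3, one_mul]

/-! ### Jackson's inequality of higher order -/

/-- Each derivative costs one degree and gains a factor n + k + 1, of which only `n` is kept. -/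
theorem norm_sub_starProjection_le_of_isWeakDeriv (n k : ℕ) (u : ℕ → L2)
    (hu : ∀ j < k, IsWeakDeriv 1 (u j) (u (j + 1))) :
    (n : ℝ) ^ k * ‖u 0 - (polySubspace (n + k)).starProjection (u 0)‖ ≤ ‖u k‖ := by
  induction k generalizing u with
  | zero =>
    rw [pow_zero, one_mul, ← Submodule.starProjection_orthogonal_val]
    exact Submodule.norm_starProjection_apply_le _ _
  | succ k ih =>
    have h := ih (fun j => u (j + 1)) fun j hj => hu (j + 1) (by omega)
    obtain ⟨c, hc⟩ := (hu 0 (by omega)).exists_eq_add_integrationOp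
    have h2 := norm_add_integrationOp_sub_starProjection_le c (u 1) (n + k)
    rw [← hc] at h2
    refine le_trans ?_ h
    rw [pow_succ, mul_assoc]
    refine mul_le_mul_of_nonneg_left (le_trans ?_ h2) (by positivity)
    refine mul_le_mul_of_nonneg_right ?_ (norm_nonneg _)
    push_cast
    have : (0 : ℝ) ≤ k := by positivity
    linarith

theorem norm_sobolevEmbedding_sub_starProjection_le {k : ℕ} (x : sobolev k) (n : ℕ) :
    (n : ℝ) ^ k * ‖sobolevEmbedding k x
      - (polySubspace (n + k)).starProjection (sobolevEmbedding k x)‖ ≤ ‖x‖ := by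
  set u : ℕ → L2 := fun j => if h : j < k + 1 then x.1 ⟨j, h⟩ else 0 with hu
  have hj : ∀ j (h : j < k + 1), u j = x.1 ⟨j, h⟩ := fun j h => dif_pos h
  have h := norm_sub_starProjection_le_of_isWeakDeriv n k u fun j hjk => by
    rw [hj j (by omega), hj (j + 1) (by omega)]
    exact (x.2 ⟨j, by omega⟩).of_succ (x.2 ⟨j + 1, by omega⟩)
  rw [hj k (by omega), hj 0 (by omega)] at h
  exact h.trans (PiLp.norm_apply_le x.1 _)

/-! ### Coefficients of a polynomial against its L² norm -/

/-- The sum of the absolute values of the coefficients of a polynomial. -/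
def coeffNorm (p : ℝ[X]) : ℝ := p.sum fun _ a => |a|

theorem coeffNorm_eq_sum_range {p : ℝ[X]} {n : ℕ} (h : p.natDegree < n) :
    coeffNorm p = ∑ j ∈ Finset.range n, |p.coeff j| :=
  Polynomial.sum_over_range' p (fun _ => abs_zero) n h

theorem coeffNorm_nonneg (p : ℝ[X]) : 0 ≤ coeffNorm p :=
  Finset.sum_nonneg fun _ _ => abs_nonneg _

theorem coeffNorm_add_le (p q : ℝ[X]) : coeffNorm (p + q) ≤ coeffNorm p + coeffNorm q := by
  set n := max p.natDegree q.natDegree + 1 with hn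
  rw [coeffNorm_eq_sum_range (n := n) ((natDegree_add_le p q).trans_lt (by omega)),
    coeffNorm_eq_sum_range (n := n) (p := p) (by omega),
    coeffNorm_eq_sum_range (n := n) (p := q) (by omega), ← Finset.sum_add_distrib]
  exact Finset.sum_le_sum fun j _ => by rw [coeff_add]; exact abs_add_le _ _

theorem coeffNorm_sum_le {ι : Type*} (s : Finset ι) (f : ι → ℝ[X]) :
    coeffNorm (∑ i ∈ s, f i) ≤ ∑ i ∈ s, coeffNorm (f i) :=
  Finset.le_sum_of_subadditive _ (by simp [coeffNorm]) coeffNorm_add_le s f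

theorem coeffNorm_C_mul (c : ℝ) (p : ℝ[X]) : coeffNorm (C c * p) = |c| * coeffNorm p := by
  rw [coeffNorm_eq_sum_range (n := p.natDegree + 1)
    ((natDegree_C_mul_le c p).trans_lt (Nat.lt_succ_self _)),
    coeffNorm_eq_sum_range (Nat.lt_succ_self _), Finset.mul_sum]
  simp [abs_mul]

theorem coeffNorm_X_mul (p : ℝ[X]) : coeffNorm (X * p) = coeffNorm p := by
  have h : (X * p).natDegree < p.natDegree + 1 + 1 := by
    have := natDegree_mul_le (p := (X : ℝ[X])) (q := p)
    rw [natDegree_X] at this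
    omega
  rw [coeffNorm_eq_sum_range h, coeffNorm_eq_sum_range (Nat.lt_succ_self _),
    Finset.sum_range_succ']
  simp

theorem coeffNorm_X_sub_C_mul_le (y : ℝ) (p : ℝ[X]) :
    coeffNorm ((X - C y) * p) ≤ (1 + |y|) * coeffNorm p := by
  have e : (X - C y) * p = X * p + C (-y) * p := by rw [C_neg]; ring
  rw [e]
  refine (coeffNorm_add_le _ _).trans_eq ?_
  rw [coeffNorm_X_mul, coeffNorm_C_mul, abs_neg]
  ring

theorem coeffNorm_prod_basisDivisor_le {ι : Type*} (s : Finset ι) (x : ℝ) (v : ι → ℝ) :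
    coeffNorm (∏ j ∈ s, Lagrange.basisDivisor x (v j))
      ≤ ∏ j ∈ s, |(x - v j)⁻¹| * (1 + |v j|) := by
  classical
  induction s using Finset.induction_on with
  | empty =>
    rw [Finset.prod_empty, Finset.prod_empty, ← C_1, ← mul_one (C 1), coeffNorm_C_mul,
      coeffNorm_eq_sum_range (n := 1) (by simp)]
    simp
  | insert i s hi ih =>
    rw [Finset.prod_insert hi, Finset.prod_insert hi, Lagrange.basisDivisor, mul_assoc,
      coeffNorm_C_mul, mul_assoc]
    refine mul_le_mul_of_nonneg_left ((coeffNorm_X_sub_C_mul_le _ _).trans ?_) (abs_nonneg _)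
    exact mul_le_mul_of_nonneg_left ih (by positivity)

theorem prod_range_erase_abs_sub (i d : ℕ) :
    ∏ j ∈ (Finset.range (i + d + 1)).erase i, |(i : ℝ) - j| = i.factorial * d.factorial := by
  induction d with
  | zero =>
    have e : (Finset.range (i + 0 + 1)).erase i = Finset.range i := by
      ext j; simp only [Finset.mem_erase, Finset.mem_range]; omega
    rw [e, ← Finset.prod_range_reflect, ← Finset.prod_range_add_one_eq_factorial]
    push_cast
    rw [Nat.factorial_zero, Nat.cast_one, mul_one]
    refine Finset.prod_congr rfl fun j hj => ?_
    have hj' := Finset.mem_range.1 hj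
    have : ((i - 1 - j : ℕ) : ℝ) = i - 1 - j := by
      rw [Nat.cast_sub (by omega), Nat.cast_sub (by omega), Nat.cast_one]
    rw [this]
    have e2 : (i : ℝ) - (i - 1 - j) = j + 1 := by ring
    rw [e2, abs_of_nonneg (by positivity)]
  | succ d ih =>
    have e : (Finset.range (i + (d + 1) + 1)).erase i
        = insert (i + d + 1) ((Finset.range (i + d + 1)).erase i) := by
      ext j; simp only [Finset.mem_erase, Finset.mem_range, Finset.mem_insert]; omega
    rw [e, Finset.prod_insert (by simp), ih, Nat.factorial_succ]
    push_cast
    have e2 : (i : ℝ) - (i + d + 1) = -(d + 1) := by ring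
    rw [e2, abs_neg, abs_of_nonneg (by positivity)]
    ring

/-- One term of the exponential series at n + 1, namely that of index n + 1. -/
theorem succ_pow_le_exp_mul_factorial (n : ℕ) :
    ((n : ℝ) + 1) ^ n ≤ Real.exp (n + 1) * n.factorial := by
  have h := Real.pow_div_factorial_le_exp (x := (n : ℝ) + 1) (by positivity) (n + 1)
  rw [Nat.factorial_succ, pow_succ, div_le_iff₀ (by positivity)] at h
  push_cast at h
  have hp : (0 : ℝ) < n + 1 := by positivity
  refine le_of_mul_le_mul_right ?_ hp
  linarith

/-- With m = n + 1, the factor for node j has coefficient sum at most 2m/|i - j|. The product is at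
most (2m)^n / (i! (n-i)!), and m^n ≤ e^m n! produces the binomial coefficient. -/
theorem coeffNorm_lagrangeBasis_le {n i : ℕ} (hi : i ≤ n) :
    coeffNorm (Lagrange.basis (Finset.range (n + 1)) (fun j : ℕ => (j : ℝ) / (n + 1)) i)
      ≤ 2 ^ n * Real.exp (n + 1) * n.choose i := by
  obtain ⟨d, rfl⟩ := Nat.exists_eq_add_of_le hi
  set m : ℝ := ((i + d : ℕ) : ℝ) + 1 with hm
  have hmp : 0 < m := by positivity
  refine (coeffNorm_prod_basisDivisor_le _ _ _).trans ?_
  have hle : ∀ j ∈ (Finset.range (i + d + 1)).erase i,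
      |((i : ℝ) / m - j / m)⁻¹| * (1 + |(j : ℝ) / m|) ≤ (2 * m) / |(i : ℝ) - j| := by
    intro j hj
    have hjm : (j : ℝ) ≤ m := by
      have := Finset.mem_range.1 (Finset.mem_of_mem_erase hj)
      have : (j : ℝ) ≤ ((i + d + 1 : ℕ) : ℝ) := by exact_mod_cast this.le
      rw [hm]; push_cast at this ⊢; linarith
    rw [← sub_div, inv_div, abs_div, abs_of_pos hmp,
      abs_of_nonneg (by positivity : (0 : ℝ) ≤ j / m), mul_comm 2,
      div_mul_eq_mul_div]
    refine div_le_div_of_nonneg_right (mul_le_mul_of_nonneg_left ?_ hmp.le) (abs_nonneg _)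
    have : (j : ℝ) / m ≤ 1 := (div_le_one hmp).2 hjm
    linarith
  refine (Finset.prod_le_prod (fun j _ => by positivity) hle).trans ?_
  rw [Finset.prod_div_distrib, prod_range_erase_abs_sub, Finset.prod_const,
    Finset.card_erase_of_mem (by simp), Finset.card_range, Nat.add_sub_cancel, mul_pow]
  have h1 := succ_pow_le_exp_mul_factorial (i + d)
  rw [← hm] at h1
  have h2 : ((i + d).choose i : ℝ) * (i.factorial * d.factorial) = (i + d).factorial := by
    have := Nat.choose_mul_factorial_mul_factorial (Nat.le_add_right i d)
    rw [Nat.add_sub_cancel_left, mul_assoc] at this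
    exact_mod_cast this
  rw [div_le_iff₀ (by positivity)]
  calc _ ≤ 2 ^ (i + d) * (Real.exp m * (i + d).factorial) := by gcongr
    _ = _ := by rw [← h2]; ring

/-- Point values of an antiderivative are controlled by the L² norm of its derivative; hence the
interpolation is applied to an antiderivative and not to the polynomial itself. -/
theorem abs_eval_le_norm_polyL2 {P : ℝ[X]} (hP : P.coeff 0 = 0) {s : ℝ} (h0 : 0 ≤ s)
    (h1 : s < 1) : |P.eval s| ≤ ‖polyL2 (derivative P)‖ := by
  rcases h0.eq_or_lt with rfl | h
  · rw [← coeff_zero_eq_eval_zero, hP, abs_zero]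
    exact norm_nonneg _
  · rw [← primitive_polyL2 hP ⟨h, h1⟩]
    exact abs_primitive_le _ ⟨h, h1⟩

theorem coeffNorm_le_of_derivative {P : ℝ[X]} {n : ℕ} (hP : P.coeff 0 = 0)
    (hn : P ∈ degreeLT ℝ (n + 1)) :
    coeffNorm P ≤ 4 ^ n * Real.exp (n + 1) * ‖polyL2 (derivative P)‖ := by
  -- Dividing by n + 1 keeps all n + 1 nodes in [0,1), where the pointwise bound is available.
  set v : ℕ → ℝ := fun j => (j : ℝ) / (n + 1) with hv
  have hnp : (0 : ℝ) < n + 1 := by positivity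
  have hinj : Set.InjOn v (Finset.range (n + 1)) := fun a _ b _ hab => by
    exact_mod_cast (div_left_inj' hnp.ne').1 hab
  have e := Lagrange.eq_interpolate hinj (f := P) (by
    rw [Finset.card_range]; exact mem_degreeLT.1 hn)
  rw [Lagrange.interpolate_apply] at e
  have h4 : ((4 : ℝ)) ^ n = 2 ^ n * ∑ i ∈ Finset.range (n + 1), (n.choose i : ℝ) := by
    have := Nat.sum_range_choose n
    have : ∑ i ∈ Finset.range (n + 1), (n.choose i : ℝ) = 2 ^ n := by exact_mod_cast this
    rw [this, ← mul_pow]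
    norm_num
  rw [e]
  refine (coeffNorm_sum_le _ _).trans ?_
  rw [← e]
  calc _ ≤ ∑ i ∈ Finset.range (n + 1),
        ‖polyL2 (derivative P)‖ * (2 ^ n * Real.exp (n + 1) * n.choose i) := by
        refine Finset.sum_le_sum fun i hi => ?_
        have hi' := Finset.mem_range.1 hi
        rw [coeffNorm_C_mul]
        refine mul_le_mul (abs_eval_le_norm_polyL2 hP (by positivity) ?_)
          (coeffNorm_lagrangeBasis_le (by omega)) (coeffNorm_nonneg _) (norm_nonneg _)
        rw [div_lt_one hnp]
        exact_mod_cast hi'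
    _ = _ := by rw [← Finset.mul_sum, ← Finset.mul_sum, h4]; ring

theorem coeffNorm_derivative_le {P : ℝ[X]} {n : ℕ} (hn : P ∈ degreeLT ℝ (n + 1)) :
    coeffNorm (derivative P) ≤ n * coeffNorm P := by
  have hP : P.natDegree < n + 1 := by
    rcases eq_or_ne P 0 with rfl | h
    · simp
    · exact (natDegree_lt_iff_degree_lt h).2 (mem_degreeLT.1 hn)
  have hd : (derivative P).natDegree < n + 1 :=
    (natDegree_derivative_le P).trans_lt (by omega)
  rw [coeffNorm_eq_sum_range hd, coeffNorm_eq_sum_range hP, Finset.sum_range_succ,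
    Finset.sum_range_succ', coeff_derivative, coeff_eq_zero_of_natDegree_lt hP, zero_mul,
    abs_zero, add_zero]
  refine le_trans ?_ (mul_le_mul_of_nonneg_left (le_add_of_nonneg_right (abs_nonneg _))
    (by positivity))
  rw [Finset.mul_sum]
  refine Finset.sum_le_sum fun j hj => ?_
  rw [coeff_derivative, abs_mul, mul_comm, abs_of_nonneg (by positivity : (0 : ℝ) ≤ j + 1)]
  refine mul_le_mul_of_nonneg_right ?_ (abs_nonneg _)
  exact_mod_cast Finset.mem_range.1 hj

/-- Differentiating the interpolated antiderivative costs a factor n ≤ 2^n, and 8^n ≤ e^(3n). Crude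
constants are harmless, as the rate in the exponent only affects the constant in front of the
logarithmic bound. -/
theorem coeffNorm_le_exp_mul_norm {p : ℝ[X]} {n : ℕ} (hp : p ∈ degreeLT ℝ n) :
    coeffNorm p ≤ Real.exp (4 * n + 1) * ‖polyL2 p‖ := by
  obtain ⟨P, rfl, hP⟩ := exists_antiderivative p
  have hn := mem_degreeLT_succ_of_derivative hp
  have h2 : (n : ℝ) ≤ 2 ^ n := by exact_mod_cast Nat.lt_two_pow_self.le
  have h8 : (8 : ℝ) ^ n ≤ Real.exp (3 * n) := by
    have : (2 : ℝ) ≤ Real.exp 1 := by linarith [Real.add_one_le_exp 1]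
    calc (8 : ℝ) ^ n = 2 ^ (3 * n) := by rw [pow_mul]; norm_num
      _ ≤ Real.exp 1 ^ (3 * n) := by gcongr
      _ = Real.exp (3 * n) := by rw [← Real.exp_nat_mul]; push_cast; ring_nf
  calc _ ≤ n * coeffNorm P := coeffNorm_derivative_le hn
    _ ≤ 2 ^ n * (4 ^ n * Real.exp (n + 1) * ‖polyL2 (derivative P)‖) :=
        mul_le_mul h2 (coeffNorm_le_of_derivative hP hn) (coeffNorm_nonneg _) (by positivity)
    _ = 8 ^ n * (Real.exp (n + 1) * ‖polyL2 (derivative P)‖) := by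
        rw [show (8 : ℝ) = 2 * 4 by norm_num, mul_pow]; ring
    _ ≤ Real.exp (3 * n) * (Real.exp (n + 1) * ‖polyL2 (derivative P)‖) := by gcongr
    _ = _ := by rw [← mul_assoc, ← Real.exp_add]; ring_nf

/-! ### Moments control the polynomial projection -/

theorem abs_moment_le (z : L2) (j : ℕ) : |moment z j| ≤ ‖hausdorffOp z‖ :=
  lp.norm_apply_le_norm (by norm_num) (hausdorffOp z) j

theorem abs_inner_polyL2_le (p : ℝ[X]) (z : L2) :
    |inner ℝ (polyL2 p) z| ≤ coeffNorm p * ‖hausdorffOp z‖ := by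
  rw [inner_polyL2_eq_sum, coeffNorm, Polynomial.sum, Polynomial.sum, Finset.sum_mul]
  refine (Finset.abs_sum_le_sum_abs _ _).trans (Finset.sum_le_sum fun j _ => ?_)
  rw [abs_mul]
  exact mul_le_mul_of_nonneg_left (abs_moment_le z j) (abs_nonneg _)

theorem norm_starProjection_le_hausdorffOp (n : ℕ) (z : L2) :
    ‖(polySubspace n).starProjection z‖ ≤ Real.exp (4 * n + 1) * ‖hausdorffOp z‖ := by
  set w := (polySubspace n).starProjection z with hw
  obtain ⟨p, hp, hpw⟩ := Submodule.mem_map.1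
    (Submodule.starProjection_apply_mem (polySubspace n) z)
  have h1 : ‖w‖ ^ 2 = inner ℝ (polyL2 p) z := by
    have h := Submodule.starProjection_inner_eq_zero (K := polySubspace n) z w
      (Submodule.starProjection_apply_mem _ _)
    rw [← hw, inner_sub_left, real_inner_self_eq_norm_sq, real_inner_comm] at h
    rw [hpw, ← hw]
    linarith
  have h2 := (le_abs_self _).trans (abs_inner_polyL2_le p z)
  have h3 := coeffNorm_le_exp_mul_norm hp
  rw [hpw, ← hw] at h3
  have h4 : ‖w‖ * ‖w‖ ≤ Real.exp (4 * n + 1) * ‖hausdorffOp z‖ * ‖w‖ := by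
    calc ‖w‖ * ‖w‖ = ‖w‖ ^ 2 := by ring
      _ ≤ coeffNorm p * ‖hausdorffOp z‖ := h1 ▸ h2
      _ ≤ Real.exp (4 * n + 1) * ‖w‖ * ‖hausdorffOp z‖ := by gcongr
      _ = _ := by ring
  rcases (norm_nonneg w).eq_or_lt with h | h
  · rw [← h]; positivity
  · exact le_of_mul_le_mul_right h4 h

/-! ### Choice of the degree -/

theorem eventually_exists_exp_add_le (k : ℕ) :
    ∀ᶠ L : ℝ in atTop, ∃ n : ℕ, 0 < n ∧
      Real.exp (4 * ((n + k : ℕ) : ℝ) + 1) * Real.exp (-L) + 1 / (n : ℝ) ^ k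
        ≤ (16 ^ k + 1) / L ^ k := by
  have ht : Tendsto (fun L : ℝ => (L / 2) ^ k * Real.exp (-(L / 2))) atTop (𝓝 0) :=
    (Real.tendsto_pow_mul_exp_neg_atTop_nhds_zero k).comp
      (tendsto_id.atTop_div_const (by norm_num : (0 : ℝ) < 2))
  have hpos : 0 < Real.exp (-(4 * k + 1)) / 2 ^ k := by positivity
  filter_upwards [ht.eventually_le_const hpos, eventually_ge_atTop 16] with L hL h16
  have hLp : 0 < L := by linarith
  have hfl := Nat.floor_le (a := L / 8) (by positivity)
  have hfl' := Nat.lt_floor_add_one (L / 8)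
  -- `L` stands for ln(1/δ). Then 4n ≤ L/2 leaves a decay e^(-L/2) that beats L^k, while L ≥ 16
  -- gives n ≥ L/16.
  set n := ⌊L / 8⌋₊ with hn
  have hnL : L / 16 ≤ n := by linarith
  have hnp : (0 : ℝ) < n := by linarith
  refine ⟨n, by exact_mod_cast hnp, ?_⟩
  have h1 : Real.exp (4 * ((n + k : ℕ) : ℝ) + 1) * Real.exp (-L) ≤ 1 / L ^ k := by
    rw [le_div_iff₀ (by positivity), ← Real.exp_add]
    calc Real.exp (4 * ((n + k : ℕ) : ℝ) + 1 + -L) * L ^ k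
        ≤ Real.exp (4 * k + 1 + -(L / 2)) * L ^ k := by
          refine mul_le_mul_of_nonneg_right (Real.exp_le_exp.2 ?_) (by positivity)
          push_cast
          linarith
      _ = Real.exp (4 * k + 1) * 2 ^ k * ((L / 2) ^ k * Real.exp (-(L / 2))) := by
          rw [Real.exp_add, div_pow]
          field_simp
      _ ≤ Real.exp (4 * k + 1) * 2 ^ k * (Real.exp (-(4 * k + 1)) / 2 ^ k) := by gcongr
      _ = 1 := by
          rw [Real.exp_neg]
          field_simp
  have h2 : 1 / (n : ℝ) ^ k ≤ 16 ^ k / L ^ k := by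
    calc 1 / (n : ℝ) ^ k ≤ 1 / (L / 16) ^ k := by gcongr
      _ = _ := by rw [div_pow, one_div_div]
  rw [add_div]
  linarith

theorem eventually_bound_le (k : ℕ) :
    ∀ᶠ δ in 𝓝[>] (0 : ℝ), ∃ n : ℕ, 0 < n ∧
      Real.exp (4 * ((n + k : ℕ) : ℝ) + 1) * δ + 1 / (n : ℝ) ^ k
        ≤ (16 ^ k + 1) / Real.log (1 / δ) ^ k := by
  have ht : Tendsto (fun δ : ℝ => Real.log (1 / δ)) (𝓝[>] 0) atTop := by
    simp_rw [one_div]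
    exact Real.tendsto_log_atTop.comp tendsto_inv_nhdsGT_zero
  filter_upwards [ht.eventually (eventually_exists_exp_add_le k), self_mem_nhdsWithin]
    with δ hδ hpos
  rwa [one_div, Real.log_inv, neg_neg, Real.exp_log hpos, ← Real.log_inv, ← one_div] at hδ

/-! ### Assembling the two estimates -/

theorem norm_le_of_approx {n : ℕ} {z : L2} {δ ε : ℝ} (hδ : ‖hausdorffOp z‖ ≤ δ)
    (hε : ‖z - (polySubspace n).starProjection z‖ ≤ ε) :
    ‖z‖ ≤ Real.exp (4 * n + 1) * δ + ε := by
  have h := norm_add_le ((polySubspace n).starProjection z)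
    (z - (polySubspace n).starProjection z)
  rw [add_sub_cancel] at h
  refine h.trans (add_le_add ((norm_starProjection_le_hausdorffOp n z).trans ?_) hε)
  gcongr

theorem norm_sobolevEmbedding_le {k n : ℕ} (hn : 0 < n) {x : sobolev k} {δ : ℝ}
    (hδ : ‖hausdorffOp (sobolevEmbedding k x)‖ ≤ δ) (hx : ‖x‖ ≤ 1) :
    ‖sobolevEmbedding k x‖ ≤ Real.exp (4 * ((n + k : ℕ) : ℝ) + 1) * δ + 1 / (n : ℝ) ^ k := by
  refine norm_le_of_approx hδ ?_
  rw [le_div_iff₀' (by positivity)]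
  exact (norm_sobolevEmbedding_sub_starProjection_le x n).trans hx

theorem norm_integrationOp_le_of_hausdorffOp {n : ℕ} (hn : 0 < n) {x : L2} {δ : ℝ}
    (hδ : ‖hausdorffOp (integrationOp x)‖ ≤ δ) (hx : ‖x‖ ≤ 1) :
    ‖integrationOp x‖ ≤ Real.exp (4 * ((n + 1 : ℕ) : ℝ) + 1) * δ + 1 / (n : ℝ) ^ 1 := by
  refine norm_le_of_approx hδ ?_
  rw [pow_one, le_div_iff₀' (by positivity)]
  -- Degree n + 1 is used only to match the form of `eventually_bound_le 1`; the extra factor is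
  -- dropped.
  refine le_trans ?_ ((norm_integrationOp_sub_starProjection_le x (n + 1)).trans hx)
  gcongr
  exact n.le_succ

/-- A real `sSup` defaults to 0 on unbounded sets, so boundedness is recorded along with the bound.
-/
theorem bddAbove_and_sSup_image_le {α : Type*} {f : α → ℝ} {s : Set α} {b : ℝ} (hb : 0 ≤ b)
    (h : ∀ x ∈ s, f x ≤ b) : BddAbove (f '' s) ∧ sSup (f '' s) ≤ b := by
  have h' : ∀ y ∈ f '' s, y ≤ b := Set.forall_mem_image.2 h
  exact ⟨⟨b, h'⟩, Real.sSup_le h' hb⟩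

end HausdorffMoment

end

theorem theorem3p1 :
    ∃ C : ℕ → ℝ, (∀ k : ℕ, 0 < C k) ∧
      (∀ k : ℕ, ∀ᶠ δ in 𝓝[>] (0 : ℝ),
        BddAbove ((fun x : HausdorffMoment.sobolev k => ‖HausdorffMoment.sobolevEmbedding k x‖) ''
          {x | ‖HausdorffMoment.hausdorffOp (HausdorffMoment.sobolevEmbedding k x)‖ ≤ δ ∧
            ‖x‖ ≤ 1}) ∧
        sSup ((fun x : HausdorffMoment.sobolev k => ‖HausdorffMoment.sobolevEmbedding k x‖) ''
          {x | ‖HausdorffMoment.hausdorffOp (HausdorffMoment.sobolevEmbedding k x)‖ ≤ δ ∧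
            ‖x‖ ≤ 1}) ≤ C k / Real.log (1 / δ) ^ k) ∧
      (∀ᶠ δ in 𝓝[>] (0 : ℝ),
        BddAbove ((fun x : HausdorffMoment.L2 => ‖HausdorffMoment.integrationOp x‖) ''
          {x | ‖HausdorffMoment.hausdorffOp (HausdorffMoment.integrationOp x)‖ ≤ δ ∧
            ‖x‖ ≤ 1}) ∧
        sSup ((fun x : HausdorffMoment.L2 => ‖HausdorffMoment.integrationOp x‖) ''
          {x | ‖HausdorffMoment.hausdorffOp (HausdorffMoment.integrationOp x)‖ ≤ δ ∧
            ‖x‖ ≤ 1}) ≤ C 0 / Real.log (1 / δ)) := by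
  -- The estimate for `k` needs only 16^k + 1; the shifted exponent makes C 0 = 17, the constant
  -- that (b) takes from the case k = 1.
  refine ⟨fun k => 16 ^ (k + 1) + 1, fun k => by positivity, fun k => ?_, ?_⟩
  · filter_upwards [HausdorffMoment.eventually_bound_le k, self_mem_nhdsWithin,
      Ioo_mem_nhdsGT (zero_lt_one' ℝ)] with δ ⟨n, hn, hle⟩ hpos hlt
    have hlog : 0 < Real.log (1 / δ) := Real.log_pos ((one_lt_div hpos).2 hlt.2)
    refine HausdorffMoment.bddAbove_and_sSup_image_le (by positivity) fun x hx =>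
      (HausdorffMoment.norm_sobolevEmbedding_le hn hx.1 hx.2).trans (hle.trans ?_)
    gcongr
    · norm_num
    · exact k.le_succ
  · filter_upwards [HausdorffMoment.eventually_bound_le 1, self_mem_nhdsWithin,
      Ioo_mem_nhdsGT (zero_lt_one' ℝ)] with δ ⟨n, hn, hle⟩ hpos hlt
    have hlog : 0 < Real.log (1 / δ) := Real.log_pos ((one_lt_div hpos).2 hlt.2)
    rw [pow_one (Real.log _)] at hle
    exact HausdorffMoment.bddAbove_and_sSup_image_le (by positivity) fun x hx =>
      (HausdorffMoment.norm_integrationOp_le_of_hausdorffOp hn hx.1 hx.2).trans hle
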